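/- Let $\mathcal C=(S,\mathit{Act},\mathbf R)$ be a continuous-time Markov decision process (CTMDP) with finite sets $S$ of states and $\mathit{Act}$ of actions and rate function $\mathbf R:S\times \mathit{Act}\times S\to\mathbb R_{\ge 0}$; let $E(s,a)=\sum_{s'}\mathbf R(s,a,s')$ be the exit rates, $\lambda_{\min}=\max_{s,a}E(s,a)$, $G\subseteq S$ a set of goal states and $T\ge 0$ a time horizon. An action $a$ is enabled in $s$ if $E(s,a)>0$. In a CTMDP, choosing an enabled action $a$ in $s$ leads to an exponentially distributed delay with rate $E(s,a)$, after which the successor $s'$ is reached with probability $\mathbf R(s,a,s')/E(s,a)$. For $\lambda\ge\lambda_{\min}$ the late uniformisation $\mathcal C^{\mathrm{late}}_\lambda$ is the CTMDP on $S$ with rates $\mathbf R(s,a,s')$ for $s'\ne s$ and $\lambda-\sum_{s''\ne s}\mathbf R(s,a,s'')$ for $s'=s$. The early uniformisation $\mathcal C^{\mathrm{early}}_\lambda$ is the CTMDP on $S\times(\{\bot\}\cup \mathit{Act})$ in which the rate from $(s,\cdot)$ under action $a$ to $(s',\circ)$ is $\mathbf R(s,a,s')$ if $\circ=\bot$, is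 $\lambda-E(s,a)$ if $\circ=a$ and $s'=s$, and is $0$ otherwise; here in a state $(s,b)$ with $b\in \mathit{Act}$ only the action $b$ is enabled (all rates under $a\neq b$ are $0$). The goal set of $\mathcal C^{\mathrm{early}}_\lambda$ is $G\times(\{\bot\}\cup \mathit{Act})$. For a CTMDP with goal set $G$ and an untimed (time-abstract) scheduler $\sigma$, i.e. one that chooses among the enabled actions on the basis of the sequence of states and actions so far but not of the delays, let $\Pr^\sigma_s$ be the induced probability measure on runs started in $s$, and let $\mathrm{Reach}^{=i}_{T}G$ be the set of runs that visit $G$ within time $T$ and take exactly $i$ steps up to time $T$. Put $$\underline{v}(s)=\sup_{\sigma}\sum_{i=0}^\infty \Pr\nolimits^\sigma_s(\mathrm{Reach}^{=i}_{T}G),\qquad \overline{v}(s)=\sum_{i=0}^\infty\sup_{\sigma} \Pr\nolimits^\sigma_s(\mathrm{Reach}^{=i}_{T}G),$$ with $\sigma$ ranging over all untimed schedulers. Then for each $x\in\{\mathrm{late},\mathrm{early}\}$ the gap $g_\lambda=\lVert\underline v-\overline v\rVert_\infty$ in $\mathcal C^x_\lambda$, where the norm is taken over all states of $\mathcal C^x_\lambda$,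 satisfies $\lim_{\lambda\to\infty}g_\lambda=0$. This holds both when $\sigma$ ranges over randomised and when it ranges over deterministic untimed schedulers. It also holds for the variant of $\mathcal C^{\mathrm{early}}_\lambda$ in which every action may be chosen in the states $(s,b)$, with the rates given by the same formula. -/

import Mathlib

open Set Filter Topology MeasureTheory ProbabilityTheory
open scoped NNReal ENNReal

noncomputable section

/-- A continuous-time Markov decision process with state set `S` and action set `A` (finite sets in
all uses), given by its rate function. -/
structure CTMDP (S A : Type*) where
  rate : S → A → S → ℝ≥0

/-- A position of a run: a state together with the action taken in it. -/
structure Loc (S A : Type*) where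
  state : S
  action : A

/-- One step of a run: a position and the delay spent there. -/
abbrev Step (S A : Type*) := Loc S A × ℝ

/-- An infinite run `s₀ a₀ t₀ s₁ a₁ t₁ …`. -/
abbrev Run (S A : Type*) := ℕ → Step S A

instance Loc.instMeasurableSpace (S A : Type*) : MeasurableSpace (Loc S A) := ⊤

instance Loc.instDiscreteMeasurableSpace (S A : Type*) : DiscreteMeasurableSpace (Loc S A) :=
  ⟨fun _ => MeasurableSpace.measurableSet_top⟩

instance Loc.instCountable (S A : Type*) [Finite S] [Finite A] : Countable (Loc S A) :=
  Function.Injective.countable (f := fun l : Loc S A => (l.state, l.action)) (by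
    rintro ⟨s, a⟩ ⟨s', a'⟩ h
    simpa using h)

namespace CTMDP

variable {S A : Type*} [Fintype S] [Fintype A]

/-- Exit rate of action `a` in state `s`. -/
def exit (M : CTMDP S A) (s : S) (a : A) : ℝ≥0 := ∑ s', M.rate s a s'

/-- Action `a` is enabled in state `s`. -/
def Enabled (M : CTMDP S A) (s : S) (a : A) : Prop := ∃ s', 0 < M.rate s a s'

/-- The successor distribution `P(s,a,s') = R(s,a,s') / exit(s,a)`. For pairs with exit rate `0`,
which no scheduler ever uses, an arbitrary value is chosen. -/
def succ (M : CTMDP S A) (s : S) (a : A) : PMF S := by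
  classical
  exact if h : (∑' s', (M.rate s a s' : ℝ≥0∞)) ≠ 0 then
    PMF.normalize (fun s' => (M.rate s a s' : ℝ≥0∞)) h (by
      rw [tsum_fintype]
      exact ENNReal.sum_ne_top.2 fun _ _ => ENNReal.coe_ne_top)
  else PMF.pure s

/-- The distribution of the delay in state `s` when action `a` is chosen: exponential with rate
`exit(s,a)`. For pairs with exit rate `0`, which no scheduler ever uses, an arbitrary value is
chosen. -/
def delay (M : CTMDP S A) (l : Loc S A) : Measure ℝ := by
  classical
  exact if 0 < M.exit l.state l.action then expMeasure (M.exit l.state l.action)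
  else Measure.dirac 0

instance instIsProbabilityMeasureDelay (M : CTMDP S A) (l : Loc S A) :
    IsProbabilityMeasure (M.delay l) := by
  unfold delay
  split_ifs with h
  · exact isProbabilityMeasure_expMeasure (by exact_mod_cast h)
  · infer_instance

/-- The delay distribution as a Markov kernel. -/
def delayKernel (M : CTMDP S A) : Kernel (Loc S A) ℝ := Kernel.ofFunOfCountable M.delay

instance instIsMarkovKernelDelayKernel (M : CTMDP S A) : IsMarkovKernel M.delayKernel :=
  ⟨fun l => inferInstanceAs (IsProbabilityMeasure (M.delay l))⟩

/-- A time-abstract (untimed) scheduler: given the list `(s₀,a₀), …, (s_{n-1},a_{n-1})` of the past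
states and actions and the current state `s_n`, but no timing information, it picks a probability
distribution over the actions enabled in `s_n`. -/
structure TAScheduler (M : CTMDP S A) where
  choose : List (S × A) → S → PMF A
  enabled : ∀ past s a, choose past s a ≠ 0 → M.Enabled s a

/-- The scheduler never randomises. -/
def TAScheduler.IsDeterministic {M : CTMDP S A} (σ : M.TAScheduler) : Prop :=
  ∀ past s, ∃ a, σ.choose past s = PMF.pure a

/-- The two usual classes of time-abstract schedulers. -/
inductive TAClass
  | randomised
  | deterministic

/-- The set of time-abstract schedulers of `M` in the given class. -/
def taSchedulers (M : CTMDP S A) : TAClass → Set M.TAScheduler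
  | .randomised => Set.univ
  | .deterministic => {σ | σ.IsDeterministic}

variable {M : CTMDP S A}

/-- Distribution of the position reached in state `s` after the given past. -/
def TAScheduler.pick (σ : M.TAScheduler) (past : List (S × A)) (s : S) : PMF (Loc S A) :=
  (σ.choose past s).map fun a => ⟨s, a⟩

/-- The positions `0, …, n` of a finite history as a list of state-action pairs. -/
def historyList {S A : Type*} {n : ℕ} (h : Finset.Iic n → Loc S A) : List (S × A) :=
  List.ofFn fun i : Fin (n + 1) =>
    let l := h ⟨i, Finset.mem_Iic.2 (Nat.lt_succ_iff.1 i.2)⟩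
    (l.state, l.action)

/-- Distribution of position `n + 1`, given the positions `0, …, n`: the successor state is drawn
from `P(s_n,a_n,·)`, then the scheduler picks the action. -/
def TAScheduler.nextLoc (σ : M.TAScheduler) {n : ℕ} (h : Finset.Iic n → Loc S A) :
    PMF (Loc S A) :=
  (M.succ (h ⟨n, Finset.mem_Iic.2 le_rfl⟩).state (h ⟨n, Finset.mem_Iic.2 le_rfl⟩).action).bind
    fun s' => σ.pick (historyList h) s'

/-- Transition kernel from the finite timed histories with steps `0, …, n` to step `n + 1`. -/
def TAScheduler.stepKernel (σ : M.TAScheduler) (n : ℕ) :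
    Kernel (Finset.Iic n → Step S A) (Step S A) :=
  (Kernel.ofFunOfCountable fun h : Finset.Iic n → Loc S A =>
    (σ.nextLoc h).toMeasure ⊗ₘ M.delayKernel).comap (fun h i => (h i).1) (by fun_prop)

instance TAScheduler.instIsMarkovKernelStepKernel (σ : M.TAScheduler) (n : ℕ) :
    IsMarkovKernel (σ.stepKernel n) := by
  have : IsMarkovKernel (Kernel.ofFunOfCountable fun h : Finset.Iic n → Loc S A =>
      (σ.nextLoc h).toMeasure ⊗ₘ M.delayKernel) :=
    ⟨fun h => inferInstanceAs
      (IsProbabilityMeasure ((σ.nextLoc h).toMeasure ⊗ₘ M.delayKernel))⟩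
  unfold TAScheduler.stepKernel
  infer_instance

/-- The probability measure on runs from the initial state `s` under the scheduler `σ`. -/
def TAScheduler.runMeasure (σ : M.TAScheduler) (s : S) : Measure (Run S A) :=
  Kernel.trajMeasure (X := fun _ => Step S A)
    ((σ.pick [] s).toMeasure ⊗ₘ M.delayKernel) (fun n => σ.stepKernel n)

/-- The time at which the `n`-th transition of the run is completed (`0` for `n = 0`). -/
def arrivalTime {S A : Type*} (ω : Run S A) (n : ℕ) : ℝ := ∑ j ∈ Finset.range n, (ω j).2

/-- The runs that visit `G` within time `T`. -/
def reach (S A : Type*) (T : ℝ) (G : Set S) : Set (Run S A) :=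
  {ω | ∃ n, (ω n).1.state ∈ G ∧ arrivalTime ω n ≤ T}

/-- The runs that visit `G` within time `T` and take exactly `i` steps up to time `T`. -/
def reachExactly (S A : Type*) (T : ℝ) (G : Set S) (i : ℕ) : Set (Run S A) :=
  {ω ∈ reach S A T G | arrivalTime ω i ≤ T ∧ T < arrivalTime ω (i + 1)}

/-- The optimal value of untimed schedulers: supremum outside the sum over step counts. -/
def lowerValue (M : CTMDP S A) (G : Set S) (T : ℝ) (c : TAClass) (s : S) : ℝ≥0∞ :=
  ⨆ σ ∈ M.taSchedulers c, ∑' i, σ.runMeasure s (reachExactly S A T G i)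

/-- The value of prophetic untimed schedulers: supremum inside the sum over step counts. -/
def upperValue (M : CTMDP S A) (G : Set S) (T : ℝ) (c : TAClass) (s : S) : ℝ≥0∞ :=
  ∑' i, ⨆ σ ∈ M.taSchedulers c, σ.runMeasure s (reachExactly S A T G i)

/-- The sup-norm distance `max_s |lowerValue s - upperValue s|`, as an extended nonnegative real
(the subtraction in `ℝ≥0∞` is truncated, so the maximum is the absolute difference). -/
def gap (M : CTMDP S A) (G : Set S) (T : ℝ) (c : TAClass) : ℝ≥0∞ :=
  ⨆ s, max (M.lowerValue G T c s - M.upperValue G T c s)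
    (M.upperValue G T c s - M.lowerValue G T c s)

/-- Late uniformisation to rate `r`. The truncated subtraction is exact as soon as `r` is at least
the maximal exit rate of `C`. -/
def lateUnif (C : CTMDP S A) (r : ℝ≥0) : CTMDP S A := by
  classical
  exact { rate := fun s a s' =>
    if s = s' then r - ∑ s'' ∈ Finset.univ.erase s, C.rate s a s'' else C.rate s a s' }

/-- Early uniformisation to rate `r`. The state `(s, none)` is the original state `s`; in the state
`(s, some b)` the commitment to `b` is frozen, i.e. only `b` is enabled. The truncated subtraction
is exact as soon as `r` is at least the maximal exit rate of `C`. -/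
def earlyUnif (C : CTMDP S A) (r : ℝ≥0) : CTMDP (S × Option A) A := by
  classical
  exact { rate := fun p a q =>
    if p.2 = none ∨ p.2 = some a then
      if q.2 = none then C.rate p.1 a q.1
      else if q.2 = some a ∧ p.1 = q.1 then r - C.exit p.1 a
      else 0
    else 0 }

/-- The variant of early uniformisation given by the bare rate formula, which does not depend on the
second component of the source state, so that actions are not frozen. -/
def earlyUnifUnfrozen (C : CTMDP S A) (r : ℝ≥0) : CTMDP (S × Option A) A := by
  classical
  exact { rate := fun p a q =>
    if q.2 = none then C.rate p.1 a q.1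
    else if q.2 = some a ∧ p.1 = q.1 then r - C.exit p.1 a
    else 0 }

end CTMDP

end

/-!
Fix a CTMDP all of whose enabled actions have the same exit rate `r`. Since untimed schedulers do
not see the delays, under every scheduler the delays are independent exponentials of rate `r`, and
they are independent of the states visited (`CTMDP.HasUniformRate.lintegral_locs_mul`, by induction
along the Ionescu-Tulcea construction). Hence the number of steps taken up to time `T` is Poisson
distributed with mean `r T` (`lintegral_erlang_count`), and the probability of reaching `G` in time
with exactly `n` steps is the Poisson weight of `n` times the probability `P σ n` of visiting `G`
within `n` steps (`CTMDP.HasUniformRate.runMeasure_reachExactly`). A prophetic scheduler thus gains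
only by knowing the Poisson variable in advance.

That knowledge is worth little. In each uniformisation the original state (the state itself, or the
first component) changes in one step with probability at most `Λ / r`, for a constant `Λ` that does
not depend on `r`; so `P σ m ≤ P σ n + (m - n) Λ / r` (`CTMDP.MovesAtRateLE.runMeasure_reachBy_le`).
Comparing every `n` with the single number `N = ⌊r T⌋` of steps shows that both values differ from
the supremum of `P σ N` over all `σ` by at most `Λ / r` times the mean distance of the Poisson
variable from `N`, which is of the order `√r` (`tsum_poisson_mul_dist_floor_le`). The gap is
therefore of the order `1 / √r`. No closure property of the set of schedulers is needed, so the
argument applies to randomised and to deterministic ones alike.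
-/

/-! ### Exponential and Erlang distributions -/

lemma expMeasure_Iio_zero {r : ℝ} : expMeasure r (Iio 0) = 0 := by
  rw [expMeasure, gammaMeasure, withDensity_apply _ measurableSet_Iio]
  exact lintegral_gammaPDF_of_nonpos le_rfl

lemma expMeasure_Ioi {r : ℝ} (hr : 0 < r) {x : ℝ} (hx : 0 ≤ x) :
    expMeasure r (Ioi x) = ENNReal.ofReal (Real.exp (-(r * x))) := by
  have := isProbabilityMeasure_expMeasure hr
  rw [← compl_Iic, prob_compl_eq_one_sub measurableSet_Iic, expMeasure, gammaMeasure,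
    withDensity_apply _ measurableSet_Iic]
  have h := lintegral_exponentialPDF_eq_antiDeriv hr x
  rw [if_pos hx] at h
  erw [h]
  rw [← ENNReal.ofReal_one, ← ENNReal.ofReal_sub]
  · congr 1; ring
  · rw [sub_nonneg, Real.exp_le_one_iff]; nlinarith

lemma lintegral_expMeasure {r : ℝ} (f : ℝ → ℝ≥0∞) :
    ∫⁻ t, f t ∂expMeasure r =
      ∫⁻ t in Ici 0, ENNReal.ofReal (r * Real.exp (-(r * t))) * f t := by
  rw [expMeasure, gammaMeasure,
    lintegral_withDensity_eq_lintegral_mul_non_measurable _ (by unfold gammaPDF; fun_prop)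
      (by simp [gammaPDF]),
    ← lintegral_indicator measurableSet_Ici]
  congr 1 with t
  have h := exponentialPDF_eq r t
  rw [exponentialPDF, exponentialPDFReal, ← gammaPDF] at h
  simp only [Pi.mul_apply, h, indicator, mem_Ici]
  split_ifs <;> simp

/-- The distribution of the sum of `n` independent exponential delays of rate `r`. -/
noncomputable def erlang (r : ℝ) : ℕ → Measure ℝ
  | 0 => Measure.dirac 0
  | n + 1 => (erlang r n).conv (expMeasure r)

lemma isProbabilityMeasure_erlang {r : ℝ} (hr : 0 < r) (n : ℕ) :
    IsProbabilityMeasure (erlang r n) := by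
  have := isProbabilityMeasure_expMeasure hr
  induction n with
  | zero => unfold erlang; infer_instance
  | succ n ih => unfold erlang; infer_instance

lemma lintegral_Icc_rate_mul_pow {r : ℝ} (hr : 0 < r) {T : ℝ} (hT : 0 ≤ T) (n : ℕ) :
    ∫⁻ t in Icc 0 T, ENNReal.ofReal (r * ((r * (T - t)) ^ n / n.factorial)) =
      ENNReal.ofReal ((r * T) ^ (n + 1) / (n + 1).factorial) := by
  rw [← ofReal_integral_eq_lintegral_ofReal]
  · congr 1
    rw [integral_Icc_eq_integral_Ioc, ← intervalIntegral.integral_of_le hT]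
    have hd : ∀ t ∈ uIcc 0 T, HasDerivAt
        (fun t => -((r * (T - t)) ^ (n + 1) / (n + 1).factorial))
        (r * ((r * (T - t)) ^ n / n.factorial)) t := by
      intro t _
      have h1 : HasDerivAt (fun t => r * (T - t)) (r * (-1)) t :=
        ((hasDerivAt_id t).const_sub T).const_mul r
      convert! ((h1.pow (n + 1)).div_const ((n + 1).factorial : ℝ)).neg using 1
      have : (n.factorial : ℝ) ≠ 0 := by positivity
      push_cast [Nat.factorial_succ]
      field_simp
    rw [intervalIntegral.integral_eq_sub_of_hasDerivAt hd
      (Continuous.intervalIntegrable (by fun_prop) _ _)]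
    simp
  · exact (Continuous.integrableOn_Icc (by fun_prop))
  · filter_upwards [ae_restrict_mem measurableSet_Icc] with t ht
    have : 0 ≤ T - t := sub_nonneg.2 ht.2
    simp only [Pi.zero_apply]
    positivity

/-- The exponentially tilted Erlang distribution function: tilting by `exp (r u)` turns the
exponential density into the constant `r`, so each convolution is a plain integration of a
power. -/
lemma lintegral_exp_erlang {r : ℝ} (hr : 0 < r) (n : ℕ) (T : ℝ) :
    ∫⁻ u, (Iic T).indicator (fun u => ENNReal.ofReal (Real.exp (r * u))) u ∂erlang r n =
      if 0 ≤ T then ENNReal.ofReal ((r * T) ^ n / n.factorial) else 0 := by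
  have := isProbabilityMeasure_expMeasure hr
  have hm (T : ℝ) : Measurable
      ((Iic T).indicator (fun u => ENNReal.ofReal (Real.exp (r * u)))) :=
    Measurable.indicator (by fun_prop) measurableSet_Iic
  induction n generalizing T with
  | zero =>
    rw [erlang, lintegral_dirac' _ (hm T)]
    simp [indicator]
  | succ n ih =>
    have := isProbabilityMeasure_erlang hr n
    rw [erlang, Measure.conv_comm, Measure.lintegral_conv (hm T)]
    have h1 (t : ℝ) : ∫⁻ u, (Iic T).indicator
        (fun u => ENNReal.ofReal (Real.exp (r * u))) (t + u) ∂erlang r n =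
        ENNReal.ofReal (Real.exp (r * t)) *
          if 0 ≤ T - t then ENNReal.ofReal ((r * (T - t)) ^ n / n.factorial) else 0 := by
      rw [← ih (T - t), ← lintegral_const_mul _ (hm _)]
      congr 1 with u
      simp only [indicator, mem_Iic, le_sub_iff_add_le']
      split_ifs
      · rw [← ENNReal.ofReal_mul (by positivity), ← Real.exp_add, mul_add]
      · simp
    simp_rw [h1]
    rw [lintegral_expMeasure]
    have h2 (t : ℝ) : ENNReal.ofReal (r * Real.exp (-(r * t))) *
        (ENNReal.ofReal (Real.exp (r * t)) *
          if 0 ≤ T - t then ENNReal.ofReal ((r * (T - t)) ^ n / n.factorial) else 0) =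
        (Iic T).indicator
          (fun t => ENNReal.ofReal (r * ((r * (T - t)) ^ n / n.factorial))) t := by
      simp only [indicator, mem_Iic, sub_nonneg]
      split_ifs
      · rw [← mul_assoc, ← ENNReal.ofReal_mul (by positivity), mul_assoc, ← Real.exp_add,
          ← ENNReal.ofReal_mul (by positivity)]
        simp
      · simp
    simp_rw [h2]
    rw [lintegral_indicator measurableSet_Iic, Measure.restrict_restrict measurableSet_Iic,
      Iic_inter_Ici]
    split_ifs with hT
    · exact lintegral_Icc_rate_mul_pow hr hT n
    · rw [Icc_eq_empty hT]; simp

/-- The number of exponential delays of rate `r` that fit into the time `T` is Poisson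
distributed with mean `r T`. -/
lemma lintegral_erlang_count {r : ℝ} (hr : 0 < r) {T : ℝ} (hT : 0 ≤ T) (n : ℕ) :
    ∫⁻ u, ∫⁻ t, {p : ℝ × ℝ | p.1 ≤ T ∧ T < p.1 + p.2}.indicator 1 (u, t) ∂expMeasure r
        ∂erlang r n =
      ENNReal.ofReal (Real.exp (-(r * T)) * ((r * T) ^ n / n.factorial)) := by
  have h (u : ℝ) : ∫⁻ t, {p : ℝ × ℝ | p.1 ≤ T ∧ T < p.1 + p.2}.indicator 1 (u, t) ∂expMeasure r =
      ENNReal.ofReal (Real.exp (-(r * T))) *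
        (Iic T).indicator (fun u => ENNReal.ofReal (Real.exp (r * u))) u := by
    by_cases hu : u ≤ T
    · have : (fun t => {p : ℝ × ℝ | p.1 ≤ T ∧ T < p.1 + p.2}.indicator (1 : ℝ × ℝ → ℝ≥0∞) (u, t)) =
          (Ioi (T - u)).indicator 1 := by
        ext t
        simp [indicator, hu, sub_lt_iff_lt_add']
      rw [this, lintegral_indicator_one measurableSet_Ioi, expMeasure_Ioi hr (sub_nonneg.2 hu),
        indicator_of_mem (mem_Iic.2 hu), ← ENNReal.ofReal_mul (by positivity), ← Real.exp_add]
      congr 2; ring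
    · simp [indicator, hu]
  simp_rw [h]
  rw [lintegral_const_mul _ (Measurable.indicator (by fun_prop) measurableSet_Iic),
    lintegral_exp_erlang hr, if_pos hT, ← ENNReal.ofReal_mul (by positivity)]

/-! ### Moments of the Poisson distribution -/

lemma hasSum_poisson (a : ℝ) :
    HasSum (fun n : ℕ => Real.exp (-a) * (a ^ n / n.factorial)) 1 := by
  have h := (NormedSpace.expSeries_div_hasSum_exp a).mul_left (Real.exp (-a))
  rwa [← Real.exp_eq_exp_ℝ, ← Real.exp_add, neg_add_cancel, Real.exp_zero] at h

lemma hasSum_poisson_mul_self (a : ℝ) :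
    HasSum (fun n : ℕ => Real.exp (-a) * (a ^ n / n.factorial) * n) a := by
  rw [← hasSum_nat_add_iff' 1]
  convert! (hasSum_poisson a).mul_left a using 1
  · ext n
    have : (n.factorial : ℝ) ≠ 0 := by positivity
    push_cast [Nat.factorial_succ]
    field_simp
    ring
  · simp

lemma hasSum_poisson_mul_sq (a : ℝ) :
    HasSum (fun n : ℕ => Real.exp (-a) * (a ^ n / n.factorial) * n ^ 2) (a ^ 2 + a) := by
  rw [← hasSum_nat_add_iff' 1]
  convert! ((hasSum_poisson_mul_self a).add (hasSum_poisson a)).mul_left a using 1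
  · ext n
    have : (n.factorial : ℝ) ≠ 0 := by positivity
    push_cast [Nat.factorial_succ]
    field_simp
    ring
  · simp; ring

lemma hasSum_poisson_variance (a : ℝ) :
    HasSum (fun n : ℕ => Real.exp (-a) * (a ^ n / n.factorial) * (n - a) ^ 2) a := by
  convert! ((hasSum_poisson_mul_sq a).sub ((hasSum_poisson_mul_self a).mul_left (2 * a))).add
    ((hasSum_poisson a).mul_left (a ^ 2)) using 1
  · ext n; ring
  · ring

/-- A Poisson variable of mean `a` is within distance `O(√a)` of `⌊a⌋₊` in mean. The free scale
`c`, to be chosen of the order `√a`, stands for the Cauchy-Schwarz inequality. -/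
lemma tsum_poisson_mul_dist_floor_le {a c : ℝ} (ha : 0 ≤ a) (hc : 0 < c) :
    ∑' n : ℕ, ENNReal.ofReal (Real.exp (-a) * (a ^ n / n.factorial)) *
      ((n - ⌊a⌋₊ + (⌊a⌋₊ - n) : ℕ) : ℝ≥0∞) ≤ ENNReal.ofReal (1 + (a / c + c) / 2) := by
  have hs := ((hasSum_poisson a).mul_left (1 + c / 2)).add
    ((hasSum_poisson_variance a).mul_left (c⁻¹ / 2))
  have hval : (1 + c / 2) * 1 + c⁻¹ / 2 * a = 1 + (a / c + c) / 2 := by ring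
  rw [hval] at hs
  have hnn (n : ℕ) : 0 ≤ Real.exp (-a) * (a ^ n / n.factorial) := by positivity
  rw [← hs.tsum_eq, ENNReal.ofReal_tsum_of_nonneg _ hs.summable]
  · refine ENNReal.tsum_le_tsum fun n => ?_
    rw [← ENNReal.ofReal_natCast, ← ENNReal.ofReal_mul (hnn n)]
    refine ENNReal.ofReal_le_ofReal ?_
    have h1 : ((n - ⌊a⌋₊ + (⌊a⌋₊ - n) : ℕ) : ℝ) ≤ |(n : ℝ) - a| + 1 := by
      have hlo := Nat.floor_le ha
      have hhi := Nat.lt_floor_add_one a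
      have hp := le_abs_self ((n : ℝ) - a)
      have hq := neg_abs_le ((n : ℝ) - a)
      rcases le_total n ⌊a⌋₊ with h | h
      · rw [Nat.sub_eq_zero_of_le h, zero_add, Nat.cast_sub h]; linarith
      · rw [Nat.sub_eq_zero_of_le h, add_zero, Nat.cast_sub h]; linarith
    -- the inequality of arithmetic and geometric means, at scale `c`
    have h2 : |(n : ℝ) - a| ≤ c⁻¹ / 2 * (n - a) ^ 2 + c / 2 := by
      have h3 : c⁻¹ / 2 * (n - a) ^ 2 + c / 2 - |(n : ℝ) - a| =
          c⁻¹ / 2 * (|(n : ℝ) - a| - c) ^ 2 := by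
        rw [← sq_abs ((n : ℝ) - a)]; field_simp; ring
      have : 0 ≤ c⁻¹ / 2 * (|(n : ℝ) - a| - c) ^ 2 := by positivity
      linarith
    nlinarith [mul_le_mul_of_nonneg_left (h1.trans (add_le_add_left h2 1)) (hnn n)]
  · intro n
    have := hnn n
    positivity

namespace CTMDP

variable {S A : Type*} [Fintype S] [Fintype A] {M : CTMDP S A}

/-! ### Runs under an untimed scheduler -/

/-- The positions `0, …, n` of a run, without the delays. -/
def locs {S A : Type*} (n : ℕ) (ω : Run S A) : Finset.Iic n → Loc S A := fun i => (ω i).1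

@[fun_prop]
lemma measurable_locs {S A : Type*} (n : ℕ) : Measurable (locs (S := S) (A := A) n) := by
  unfold locs; fun_prop

@[fun_prop]
lemma measurable_arrivalTime {S A : Type*} (n : ℕ) :
    Measurable fun ω : Run S A => arrivalTime ω n := by
  unfold arrivalTime; fun_prop

lemma arrivalTime_succ {S A : Type*} (ω : Run S A) (n : ℕ) :
    arrivalTime ω (n + 1) = arrivalTime ω n + (ω n).2 := Finset.sum_range_succ _ _

instance (σ : M.TAScheduler) (s : S) : IsProbabilityMeasure (σ.runMeasure s) := by
  unfold TAScheduler.runMeasure; infer_instance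

lemma enabled_of_mem_support_pick {S A : Type*} {M : CTMDP S A} (σ : M.TAScheduler)
    {past : List (S × A)} {s : S} {l : Loc S A} (hl : l ∈ (σ.pick past s).support) :
    l.state = s ∧ M.Enabled l.state l.action := by
  simp only [TAScheduler.pick, PMF.mem_support_map_iff] at hl
  obtain ⟨a, ha, rfl⟩ := hl
  exact ⟨rfl, σ.enabled past s a ha⟩

lemma enabled_of_mem_support_nextLoc {S A : Type*} [Fintype S] {M : CTMDP S A}
    (σ : M.TAScheduler) {n : ℕ} {h : Finset.Iic n → Loc S A} {l : Loc S A} (hl : l ∈ (σ.nextLoc h).support) :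
    M.Enabled l.state l.action := by
  simp only [TAScheduler.nextLoc, PMF.mem_support_bind_iff] at hl
  obtain ⟨s', -, hl⟩ := hl
  exact (enabled_of_mem_support_pick σ hl).2

/-! ### Independence of positions and delays -/

/-- Every enabled action has the same exit rate `r`. -/
def HasUniformRate (M : CTMDP S A) (r : ℝ≥0) : Prop :=
  ∀ s a, M.Enabled s a → M.exit s a = r

/-- Under a uniform exit rate the delay is independent of the position. -/
lemma HasUniformRate.compProd_delayKernel {r : ℝ≥0} (hM : M.HasUniformRate r) (hr : 0 < r)
    (p : PMF (Loc S A)) (hp : ∀ l ∈ p.support, M.Enabled l.state l.action) :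
    p.toMeasure ⊗ₘ M.delayKernel = p.toMeasure.prod (expMeasure r) := by
  have := isProbabilityMeasure_expMeasure (r := r) (by exact_mod_cast hr)
  rw [← Measure.compProd_const]
  refine Measure.compProd_congr ?_
  rw [Filter.EventuallyEq, ae_iff, PMF.toMeasure_apply_eq_zero_iff _ .of_discrete,
    disjoint_left]
  intro l hl hne
  refine hne ?_
  have he := hM _ _ (hp l hl)
  change M.delay l = _
  rw [delay, he, if_pos hr]
  rfl

lemma HasUniformRate.stepKernel_apply {r : ℝ≥0} (hM : M.HasUniformRate r) (hr : 0 < r)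
    (σ : M.TAScheduler) (n : ℕ) (h : Finset.Iic n → Step S A) :
    σ.stepKernel n h = (σ.nextLoc fun i => (h i).1).toMeasure.prod (expMeasure r) :=
  hM.compProd_delayKernel hr _ fun _ => enabled_of_mem_support_nextLoc σ

lemma lintegral_runMeasure_zero (σ : M.TAScheduler) (s : S) {F : Step S A → ℝ≥0∞}
    (hF : Measurable F) :
    ∫⁻ ω, F (ω 0) ∂σ.runMeasure s =
      ∫⁻ x, F x ∂((σ.pick [] s).toMeasure ⊗ₘ M.delayKernel) := by
  have h : (σ.runMeasure s).map (Preorder.frestrictLe 0) =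
      ((σ.pick [] s).toMeasure ⊗ₘ M.delayKernel).map
        (MeasurableEquiv.piUnique fun _ : Finset.Iic 0 => Step S A).symm := by
    rw [TAScheduler.runMeasure, Kernel.trajMeasure, Measure.map_comp _ _ (by fun_prop),
      Kernel.traj_map_frestrictLe, Kernel.partialTraj_self, Measure.id_comp]
  have h2 := congrArg (fun μ => ∫⁻ x, F (x ⟨0, Finset.mem_Iic.2 le_rfl⟩) ∂μ) h
  rwa [lintegral_map (by fun_prop) (by fun_prop), lintegral_map (by fun_prop) (by fun_prop)] at h2

lemma lintegral_runMeasure_succ (σ : M.TAScheduler) (s : S) (n : ℕ)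
    {F : (Finset.Iic n → Step S A) → Step S A → ℝ≥0∞} (hF : Measurable (Function.uncurry F)) :
    ∫⁻ ω, F (fun i => ω i) (ω (n + 1)) ∂σ.runMeasure s =
      ∫⁻ ω, ∫⁻ x, F (fun i => ω i) x ∂σ.stepKernel n (fun i => ω i) ∂σ.runMeasure s := by
  have h := Kernel.map_frestrictLe_trajMeasure_compProd_eq_map_trajMeasure (X := fun _ => Step S A)
    (μ₀ := (σ.pick [] s).toMeasure ⊗ₘ M.delayKernel) (κ := fun n => σ.stepKernel n) (a := n)
  have h2 := congrArg (fun μ => ∫⁻ x, Function.uncurry F x ∂μ) h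
  rw [lintegral_map hF (by fun_prop), Measure.lintegral_compProd hF, lintegral_map _ (by fun_prop)]
    at h2
  · exact h2.symm
  · exact hF.lintegral_kernel_prod_right'

/-- Under a uniform exit rate `r` the delays of a run are independent exponentials of rate `r`,
independent of the positions as well, since an untimed scheduler ignores them. -/
theorem HasUniformRate.lintegral_locs_mul {r : ℝ≥0} (hM : M.HasUniformRate r) (hr : 0 < r)
    (σ : M.TAScheduler) (s : S) (n : ℕ) (f : (Finset.Iic n → Loc S A) → ℝ≥0∞)
    {g : ℝ → ℝ → ℝ≥0∞} (hg : Measurable (Function.uncurry g)) :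
    ∫⁻ ω, f (locs n ω) * g (arrivalTime ω n) (ω n).2 ∂σ.runMeasure s =
      (∫⁻ ω, f (locs n ω) ∂σ.runMeasure s) * ∫⁻ u, ∫⁻ t, g u t ∂expMeasure r ∂erlang r n := by
  have := isProbabilityMeasure_expMeasure (r := r) (by exact_mod_cast hr)
  have hf' {n : ℕ} (f : (Finset.Iic n → Loc S A) → ℝ≥0∞) : Measurable f := .of_discrete
  induction n generalizing g with
  | zero =>
    have hg0 : Measurable (g 0) := hg.of_uncurry_left
    have h1 := lintegral_runMeasure_zero σ s (F := fun x => f (fun _ => x.1) * g 0 x.2)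
      (by have := hf' f; fun_prop)
    have h2 := lintegral_runMeasure_zero σ s (F := fun x => f (fun _ => x.1))
      (by have := hf' f; fun_prop)
    have hl (ω : Run S A) : locs 0 ω = fun _ => (ω 0).1 := by
      ext i; obtain ⟨i, hi⟩ := i
      obtain rfl : i = 0 := by simpa using hi
      rfl
    rw [hM.compProd_delayKernel hr _
      fun l hl => (enabled_of_mem_support_pick σ hl).2] at h1 h2
    rw [erlang, lintegral_dirac' _ (f := fun u => ∫⁻ t, g u t ∂expMeasure r)
      hg.lintegral_prod_right']
    simp only [hl, arrivalTime, Finset.range_zero, Finset.sum_empty]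
    rw [h1, h2, lintegral_prod_mul (f := fun l => f fun _ => l) (g := g 0)
      (Measurable.of_discrete).aemeasurable hg0.aemeasurable]
    congr 1
    rw [lintegral_prod _ (by have := hf' f; fun_prop)]
    simp
  | succ n ih =>
    -- the positions `0, …, n` extended by a further position
    let e : (Finset.Iic n → Loc S A) → Loc S A → (Finset.Iic (n + 1) → Loc S A) :=
      fun h l i => if hi : i.1 ≤ n then h ⟨i, Finset.mem_Iic.2 hi⟩ else l
    have he (ω : Run S A) : locs (n + 1) ω = e (locs n ω) (ω (n + 1)).1 := by
      ext i
      simp only [locs, e]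
      split_ifs with hi
      · rfl
      · rw [show i.1 = n + 1 by have := Finset.mem_Iic.1 i.2; omega]
    have hfe : Measurable fun p : (Finset.Iic n → Loc S A) × Loc S A => f (e p.1 p.2) :=
      .of_discrete
    have key {g : ℝ → ℝ → ℝ≥0∞} (hg : Measurable (Function.uncurry g)) :
        ∫⁻ ω, f (locs (n + 1) ω) * g (arrivalTime ω (n + 1)) (ω (n + 1)).2 ∂σ.runMeasure s =
        (∫⁻ ω, ∫⁻ l, f (e (locs n ω) l) ∂(σ.nextLoc (locs n ω)).toMeasure ∂σ.runMeasure s) *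
          ∫⁻ u, ∫⁻ t, g u t ∂expMeasure r ∂erlang r (n + 1) := by
      have hG : Measurable fun u => ∫⁻ t, g u t ∂expMeasure r := hg.lintegral_prod_right'
      have h1 := lintegral_runMeasure_succ σ s n
        (F := fun h x => f (e (fun i => (h i).1) x.1) *
          g (∑ j : Finset.Iic n, (h j).2) x.2) (by
            refine Measurable.mul (hfe.comp (f := fun p : (Finset.Iic n → Step S A) × Step S A =>
              ((fun i => (p.1 i).1), p.2.1)) (by fun_prop)) (hg.comp
                (f := fun p : (Finset.Iic n → Step S A) × Step S A =>
              (∑ j : Finset.Iic n, (p.1 j).2, p.2.2)) (by fun_prop)))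
      have harr (ω : Run S A) : ∑ j : Finset.Iic n, (ω j).2 = arrivalTime ω (n + 1) := by
        rw [arrivalTime, Finset.sum_coe_sort (Finset.Iic n) (fun j => (ω j).2)]
        congr 1; ext j; simp
      simp only [harr, hM.stepKernel_apply hr] at h1
      simp only [he]
      refine h1.trans ?_
      have h2 (ω : Run S A) :
          ∫⁻ x, f (e (locs n ω) x.1) * g (arrivalTime ω (n + 1)) x.2
            ∂(σ.nextLoc (locs n ω)).toMeasure.prod (expMeasure r) =
          (∫⁻ l, f (e (locs n ω) l) ∂(σ.nextLoc (locs n ω)).toMeasure) *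
            ∫⁻ t, g (arrivalTime ω n + (ω n).2) t ∂expMeasure r := by
        rw [lintegral_prod_mul (f := fun l => f (e (locs n ω) l))
          (Measurable.of_discrete).aemeasurable (hg.of_uncurry_left).aemeasurable,
          arrivalTime_succ]
      refine (lintegral_congr h2).trans ?_
      rw [ih (fun h => ∫⁻ l, f (e h l) ∂(σ.nextLoc h).toMeasure)
        (g := fun u v => ∫⁻ t, g (u + v) t ∂expMeasure r) (hG.comp measurable_add),
        erlang, Measure.lintegral_conv hG]
    have := isProbabilityMeasure_erlang (r := r) (by exact_mod_cast hr) (n + 1)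
    -- for `g = 1` the same computation identifies the factor that belongs to the positions
    rw [key hg]
    congr 1
    simpa using (key (g := 1) measurable_const).symm

/-! ### Reaching the goal with a given number of steps -/

/-- The runs that visit `G` within the first `n` steps. -/
def reachBy {S : Type*} (A : Type*) (G : Set S) (n : ℕ) : Set (Run S A) :=
  {ω | ∃ m ≤ n, (ω m).1.state ∈ G}

lemma reachBy_eq_preimage {S A : Type*} (G : Set S) (n : ℕ) :
    reachBy A G n = locs n ⁻¹' {h | ∃ i, (h i).state ∈ G} := by
  ext ω
  simp only [reachBy, locs, mem_ofPred_eq, mem_preimage, Subtype.exists, Finset.mem_Iic,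
    exists_prop]

lemma reachBy_mono {S A : Type*} (G : Set S) : Monotone (reachBy A G) :=
  fun _ _ hmn _ ⟨k, hk, hG⟩ => ⟨k, hk.trans hmn, hG⟩

/-- The Poisson weight of mean `a` at `n`. -/
noncomputable def poissonWeight (a : ℝ) (n : ℕ) : ℝ≥0∞ :=
  ENNReal.ofReal (Real.exp (-a) * (a ^ n / n.factorial))

lemma HasUniformRate.ae_nonneg_delay {r : ℝ≥0} (hM : M.HasUniformRate r) (hr : 0 < r)
    (σ : M.TAScheduler) (s : S) : ∀ᵐ ω ∂σ.runMeasure s, ∀ n, 0 ≤ (ω n).2 := by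
  refine ae_all_iff.2 fun n => ?_
  have hm : Measurable ((Iio (0 : ℝ)).indicator (1 : ℝ → ℝ≥0∞)) :=
    measurable_one.indicator measurableSet_Iio
  have h := hM.lintegral_locs_mul hr σ s n (fun _ => 1)
    (g := fun _ t => (Iio 0).indicator 1 t) (hm.comp measurable_snd)
  simp only [lintegral_indicator_one measurableSet_Iio, expMeasure_Iio_zero, one_mul,
    lintegral_zero, mul_zero] at h
  rw [lintegral_eq_zero_iff (f := fun ω : Run S A => (Iio (0 : ℝ)).indicator 1 (ω n).2)
    (hm.comp (by fun_prop))] at h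
  filter_upwards [h] with ω hω
  by_contra hlt
  simp [indicator, not_le.1 hlt] at hω

/-- Independence of delays and positions: the probability of reaching `G` in time with exactly `n`
steps is the Poisson weight of `n` times the probability of reaching `G` within `n` steps. -/
theorem HasUniformRate.runMeasure_reachExactly {r : ℝ≥0} (hM : M.HasUniformRate r) (hr : 0 < r)
    (σ : M.TAScheduler) (s : S) (G : Set S) {T : ℝ} (hT : 0 ≤ T) (n : ℕ) :
    σ.runMeasure s (reachExactly S A T G n) =
      poissonWeight (r * T) n * σ.runMeasure s (reachBy A G n) := by
  let E : Set (ℝ × ℝ) := {p | p.1 ≤ T ∧ T < p.1 + p.2}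
  have hEm : MeasurableSet E :=
    (measurableSet_le measurable_fst measurable_const).inter
      (measurableSet_lt measurable_const (measurable_fst.add measurable_snd))
  have hset : reachExactly S A T G n =ᵐ[σ.runMeasure s]
      (reachBy A G n ∩ (fun ω => (arrivalTime ω n, (ω n).2)) ⁻¹' E : Set (Run S A)) := by
    refine Filter.eventuallyEq_set.2 ?_
    -- nonnegative delays make the states visited up to time `T` exactly those at steps `≤ n`
    filter_upwards [hM.ae_nonneg_delay hr σ s] with ω hω
    have hmono : Monotone (arrivalTime ω) := monotone_nat_of_le_succ fun k => by
      rw [arrivalTime_succ]; linarith [hω k]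
    have hE' : (arrivalTime ω n, (ω n).2) ∈ E ↔
        arrivalTime ω n ≤ T ∧ T < arrivalTime ω (n + 1) := by rw [arrivalTime_succ]; rfl
    rw [mem_inter_iff, mem_preimage, hE']
    constructor
    · rintro ⟨⟨m, hm, hmT⟩, h1, h2⟩
      exact ⟨⟨m, Nat.lt_succ_iff.1 (hmono.reflect_lt (hmT.trans_lt h2)), hm⟩, h1, h2⟩
    · rintro ⟨⟨m, hmn, hm⟩, h1, h2⟩
      exact ⟨⟨m, hm, (hmono hmn).trans h1⟩, h1, h2⟩
  have hind := hM.lintegral_locs_mul hr σ s n ({h | ∃ i, (h i).state ∈ G}.indicator 1)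
    (g := fun u t => E.indicator 1 (u, t)) (measurable_one.indicator hEm)
  have hB : MeasurableSet (reachBy A G n) := by
    rw [reachBy_eq_preimage]; exact measurable_locs n .of_discrete
  have hl (ω : Run S A) : {h : Finset.Iic n → Loc S A | ∃ i, (h i).state ∈ G}.indicator
      (1 : (Finset.Iic n → Loc S A) → ℝ≥0∞) (locs n ω) = (reachBy A G n).indicator 1 ω := by
    rw [reachBy_eq_preimage]; rfl
  simp only [hl] at hind
  rw [lintegral_erlang_count (by exact_mod_cast hr) hT, lintegral_indicator_one hB] at hind
  rw [measure_congr hset, mul_comm, poissonWeight, ← hind, ← lintegral_indicator_one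
    (hB.inter (hEm.preimage (by fun_prop)))]
  refine lintegral_congr fun ω => ?_
  rw [inter_indicator_one, Pi.mul_apply]
  rfl

/-! ### Rare moves of the projected state -/

variable {S₀ : Type*}

/-- The projection `π` of the state space changes at rate at most `Λ`. -/
def MovesAtRateLE {S A : Type*} [Fintype S] (M : CTMDP S A) (π : S → S₀) (Λ : ℝ≥0) : Prop :=
  ∀ s a, ∑ s', {s' | π s' ≠ π s}.indicator (M.rate s a) s' ≤ Λ

lemma MovesAtRateLE.tsum_succ_le {S A : Type*} [Fintype S] {M : CTMDP S A} {π : S → S₀}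
    {r Λ : ℝ≥0} (hπ : M.MovesAtRateLE π Λ)
    (hM : M.HasUniformRate r) (s : S) (a : A) :
    ∑' s', M.succ s a s' * {s' | π s' ≠ π s}.indicator 1 s' ≤ (Λ / r : ℝ≥0∞) := by
  by_cases h : (∑' s', (M.rate s a s' : ℝ≥0∞)) ≠ 0
  · have he : M.Enabled s a := by
      by_contra hne
      simp only [Enabled, not_exists, not_lt, nonpos_iff_eq_zero] at hne
      simp [hne] at h
    have hsum : ∑' s', (M.rate s a s' : ℝ≥0∞) = r := by
      rw [tsum_fintype, ← hM s a he, exit]; push_cast; rfl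
    have hterm (s' : S) : M.succ s a s' * {s' | π s' ≠ π s}.indicator 1 s' =
        (({s' | π s' ≠ π s}.indicator (M.rate s a) s' : ℝ≥0) : ℝ≥0∞) * (r : ℝ≥0∞)⁻¹ := by
      rw [succ, dif_pos h, PMF.normalize_apply, hsum]
      by_cases hs : π s' ≠ π s <;> simp [indicator, hs]
    simp_rw [hterm]
    rw [ENNReal.tsum_mul_right, tsum_fintype, div_eq_mul_inv]
    gcongr
    exact_mod_cast hπ s a
  -- without any rate, `succ` stays in `s` by convention, so the projection does not change
  · rw [succ, dif_neg h, ENNReal.tsum_eq_zero.2]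
    · exact zero_le
    · intro s'
      by_cases hs : s' = s <;> simp [hs]

lemma MovesAtRateLE.runMeasure_change_le {π : S → S₀} {r Λ : ℝ≥0} (hπ : M.MovesAtRateLE π Λ)
    (hM : M.HasUniformRate r) (σ : M.TAScheduler) (s : S) (n : ℕ) :
    σ.runMeasure s {ω | π (ω (n + 1)).1.state ≠ π (ω n).1.state} ≤ (Λ / r : ℝ≥0∞) := by
  let c : Loc S A → Loc S A → ℝ≥0∞ := fun l l' => {l' | π l'.state ≠ π l.state}.indicator 1 l'
  have hc : Measurable fun p : Loc S A × Loc S A => c p.1 p.2 := .of_discrete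
  have hn : n ∈ Finset.Iic n := Finset.mem_Iic.2 le_rfl
  have h := lintegral_runMeasure_succ σ s n (F := fun h x => c (h ⟨n, hn⟩).1 x.1)
    (hc.comp (f := fun p : (Finset.Iic n → Step S A) × Step S A => ((p.1 ⟨n, hn⟩).1, p.2.1))
      (by fun_prop))
  have hcm (l : Loc S A) : Measurable (c l) := .of_discrete
  have hset : MeasurableSet {ω : Run S A | π (ω (n + 1)).1.state ≠ π (ω n).1.state} :=
    measurableSet_preimage (f := fun ω : Run S A => ((ω n).1, (ω (n + 1)).1)) (by fun_prop)
      (MeasurableSet.of_discrete (s := {p : Loc S A × Loc S A | π p.2.state ≠ π p.1.state}))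
  rw [← lintegral_indicator_one hset]
  refine (Eq.trans ?_ h).trans_le ?_
  · rfl
  refine (lintegral_mono fun ω => ?_).trans_eq
    ((lintegral_const _).trans (by rw [measure_univ, mul_one]))
  change ∫⁻ x, c (ω n).1 x.1 ∂((σ.nextLoc fun i => (ω i).1).toMeasure ⊗ₘ M.delayKernel) ≤ _
  rw [Measure.lintegral_compProd (f := fun x => c (ω n).1 x.1)
    ((hcm _).comp measurable_fst)]
  simp only [lintegral_const, measure_univ, mul_one]
  refine le_trans (le_of_eq ?_) (hπ.tsum_succ_le hM (ω n).1.state (ω n).1.action)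
  have hL : MeasurableSet {l' : Loc S A | π l'.state ≠ π (ω n).1.state} := .of_discrete
  change ∫⁻ l, ({l' : Loc S A | π l'.state ≠ π (ω n).1.state}.indicator 1) l ∂_ = _
  rw [lintegral_indicator_one hL, TAScheduler.nextLoc, PMF.toMeasure_bind_apply _ _ _ hL]
  refine tsum_congr fun s' => ?_
  congr 1
  by_cases hs : π s' ≠ π (ω n).1.state
  · rw [indicator_of_mem (by exact hs), Pi.one_apply, PMF.toMeasure_apply_eq_one_iff _ hL]
    intro l hl
    rwa [← (enabled_of_mem_support_pick σ hl).1] at hs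
  · rw [indicator_of_notMem (by exact hs), PMF.toMeasure_apply_eq_zero_iff _ hL, disjoint_left]
    intro l hl
    rwa [← (enabled_of_mem_support_pick σ hl).1] at hs

/-- Further steps hardly help: each of them reaches `G` for the first time with probability at most
`Λ / r`, as the projection that decides membership in `G` has to change. -/
lemma MovesAtRateLE.runMeasure_reachBy_le {π : S → S₀} {r Λ : ℝ≥0} (hπ : M.MovesAtRateLE π Λ)
    (hM : M.HasUniformRate r) (σ : M.TAScheduler) (s : S) (G : Set S₀) (m n : ℕ) :
    σ.runMeasure s (reachBy A (π ⁻¹' G) m) ≤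
      σ.runMeasure s (reachBy A (π ⁻¹' G) n) + ((m - n : ℕ) : ℝ≥0∞) * (Λ / r) := by
  rcases le_total m n with hmn | hnm
  · exact (measure_mono (reachBy_mono _ hmn)).trans le_self_add
  obtain ⟨k, rfl⟩ := Nat.exists_eq_add_of_le hnm
  rw [Nat.add_sub_cancel_left]
  clear hnm
  induction k with
  | zero => simp
  | succ k ih =>
    have hsub : reachBy A (π ⁻¹' G) (n + (k + 1)) ⊆ reachBy A (π ⁻¹' G) (n + k) ∪
        {ω | π (ω (n + k + 1)).1.state ≠ π (ω (n + k)).1.state} := by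
      rintro ω ⟨i, hi, hG⟩
      rcases Nat.lt_or_ge (n + k) i with hlt | hle
      · obtain rfl : i = n + k + 1 := by omega
        by_cases hc : π (ω (n + k + 1)).1.state = π (ω (n + k)).1.state
        · exact Or.inl ⟨n + k, le_rfl, by rwa [mem_preimage, hc] at hG⟩
        · exact Or.inr hc
      · exact Or.inl ⟨i, hle, hG⟩
    refine ((measure_mono hsub).trans (measure_union_le _ _)).trans ?_
    refine (add_le_add ih (hπ.runMeasure_change_le hM σ s (n + k))).trans_eq ?_
    push_cast
    ring

/-! ### The gap under a uniform exit rate -/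

lemma lowerValue_le_upperValue (M : CTMDP S A) (G : Set S) (T : ℝ) (c : TAClass) (s : S) :
    M.lowerValue G T c s ≤ M.upperValue G T c s :=
  iSup₂_le fun σ hσ => ENNReal.tsum_le_tsum fun i =>
    le_iSup₂ (f := fun (σ : M.TAScheduler) (_ : σ ∈ M.taSchedulers c) =>
      σ.runMeasure s (reachExactly S A T G i)) σ hσ

lemma tsum_poissonWeight {a : ℝ} (ha : 0 ≤ a) : ∑' n, poissonWeight a n = 1 := by
  unfold poissonWeight
  rw [← ENNReal.ofReal_tsum_of_nonneg (fun n => by positivity) (hasSum_poisson a).summable,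
    (hasSum_poisson a).tsum_eq, ENNReal.ofReal_one]

/-- Both values differ from the best probability of reaching `G` within `N` steps by at most
`Λ / r` times the mean distance of the Poisson step count from `N`. -/
theorem MovesAtRateLE.gap_le_tsum {π : S → S₀} {r Λ : ℝ≥0} (hπ : M.MovesAtRateLE π Λ)
    (hM : M.HasUniformRate r) (hr : 0 < r) (G : Set S₀) {T : ℝ} (hT : 0 ≤ T) (c : TAClass)
    (N : ℕ) :
    M.gap (π ⁻¹' G) T c ≤
      2 * ((∑' n, poissonWeight (r * T) n * ((n - N + (N - n) : ℕ) : ℝ≥0∞)) * (Λ / r)) := by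
  set D := ∑' n, poissonWeight (r * T) n * ((n - N + (N - n) : ℕ) : ℝ≥0∞) with hD
  have hψ : ∑' n, poissonWeight (r * T) n = 1 := tsum_poissonWeight (by positivity)
  refine iSup_le fun s => max_le ?_ ?_
  · rw [tsub_eq_zero_of_le (lowerValue_le_upperValue ..)]; exact zero_le
  let P : M.TAScheduler → ℕ → ℝ≥0∞ := fun σ n => σ.runMeasure s (reachBy A (π ⁻¹' G) n)
  let V : ℝ≥0∞ := ⨆ σ ∈ M.taSchedulers c, P σ N
  have hV (σ) (hσ : σ ∈ M.taSchedulers c) : P σ N ≤ V :=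
    le_iSup₂ (f := fun (σ : M.TAScheduler) (_ : σ ∈ M.taSchedulers c) => P σ N) σ hσ
  have hup : M.upperValue (π ⁻¹' G) T c s ≤ V + D * (Λ / r) := by
    calc M.upperValue (π ⁻¹' G) T c s
        ≤ ∑' n, (poissonWeight (r * T) n * V + poissonWeight (r * T) n *
            ((n - N + (N - n) : ℕ) : ℝ≥0∞) * (Λ / r)) := by
          refine ENNReal.tsum_le_tsum fun n => iSup₂_le fun σ hσ => ?_
          rw [hM.runMeasure_reachExactly hr σ s _ hT, mul_assoc, ← mul_add]
          gcongr
          refine (hπ.runMeasure_reachBy_le hM σ s G n N).trans ?_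
          gcongr
          · exact hV σ hσ
          · exact Nat.le_add_right _ _
      _ = V + D * (Λ / r) := by
          rw [ENNReal.tsum_add, ENNReal.tsum_mul_right, ENNReal.tsum_mul_right, hψ, one_mul]
  have hlow : V ≤ M.lowerValue (π ⁻¹' G) T c s + D * (Λ / r) := by
    refine iSup₂_le fun σ hσ => ?_
    calc P σ N = ∑' n, poissonWeight (r * T) n * P σ N := by
          rw [ENNReal.tsum_mul_right, hψ, one_mul]
      _ ≤ ∑' n, (σ.runMeasure s (reachExactly S A T (π ⁻¹' G) n) + poissonWeight (r * T) n *
            ((n - N + (N - n) : ℕ) : ℝ≥0∞) * (Λ / r)) := by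
          refine ENNReal.tsum_le_tsum fun n => ?_
          rw [hM.runMeasure_reachExactly hr σ s _ hT, mul_assoc, ← mul_add]
          gcongr
          refine (hπ.runMeasure_reachBy_le hM σ s G N n).trans ?_
          gcongr
          exact Nat.le_add_left _ _
      _ ≤ M.lowerValue (π ⁻¹' G) T c s + D * (Λ / r) := by
          rw [ENNReal.tsum_add, ENNReal.tsum_mul_right]
          gcongr
          exact le_iSup₂ (f := fun (σ : M.TAScheduler) (_ : σ ∈ M.taSchedulers c) =>
            ∑' i, σ.runMeasure s (reachExactly S A T (π ⁻¹' G) i)) σ hσ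
  rw [tsub_le_iff_left, two_mul, ← add_assoc]
  exact hup.trans (by gcongr)

/-- The gap is of the order `1 / √r`. -/
theorem MovesAtRateLE.gap_le {π : S → S₀} {r Λ : ℝ≥0} (hπ : M.MovesAtRateLE π Λ)
    (hM : M.HasUniformRate r) (hr : 0 < r) (G : Set S₀) {T : ℝ} (hT : 0 ≤ T) (c : TAClass) :
    M.gap (π ⁻¹' G) T c ≤
      ENNReal.ofReal (2 * ((1 / r + (T + 1) / 2 * (1 / √(r : ℝ))) * Λ)) := by
  have hr' : (0 : ℝ) < r := by exact_mod_cast hr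
  have hs : 0 < √(r : ℝ) := Real.sqrt_pos.2 hr'
  refine (hπ.gap_le_tsum hM hr G hT c ⌊r * T⌋₊).trans ?_
  have h := tsum_poisson_mul_dist_floor_le (a := r * T) (by positivity) hs
  refine (mul_le_mul_right (mul_le_mul_left h _) 2).trans_eq ?_
  have h2 : (Λ / r : ℝ≥0∞) = ENNReal.ofReal (Λ / r) := by
    rw [ENNReal.ofReal_div_of_pos hr', ENNReal.ofReal_coe_nnreal, ENNReal.ofReal_coe_nnreal]
  rw [h2, ← ENNReal.ofReal_mul (by positivity), ← ENNReal.ofReal_ofNat 2,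
    ← ENNReal.ofReal_mul (by positivity)]
  congr 1
  have hsq : (r : ℝ) = √(r : ℝ) * √(r : ℝ) := (Real.mul_self_sqrt hr'.le).symm
  generalize √(r : ℝ) = x at hs hsq
  rw [hsq]
  field_simp

/-- A family of CTMDPs with uniform exit rates `r → ∞` whose projected states move at a bounded rate
has vanishing gap. -/
theorem tendsto_gap_zero {M : ℝ≥0 → CTMDP S A} {π : S → S₀} {Λ : ℝ≥0}
    (hM : ∀ᶠ r in atTop, (M r).HasUniformRate r) (hπ : ∀ᶠ r in atTop, (M r).MovesAtRateLE π Λ)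
    (G : Set S₀) {T : ℝ} (hT : 0 ≤ T) (c : TAClass) :
    Tendsto (fun r => (M r).gap (π ⁻¹' G) T c) atTop (𝓝 0) := by
  have hcoe : Tendsto (fun r : ℝ≥0 => (r : ℝ)) atTop atTop := NNReal.tendsto_coe_atTop.2 tendsto_id
  have hlim : Tendsto (fun r : ℝ≥0 => ENNReal.ofReal
      (2 * ((1 / r + (T + 1) / 2 * (1 / √(r : ℝ))) * Λ))) atTop (𝓝 0) := by
    rw [← ENNReal.ofReal_zero]
    refine ENNReal.tendsto_ofReal ?_
    have h1 : Tendsto (fun r : ℝ≥0 => 1 / (r : ℝ)) atTop (𝓝 0) := hcoe.const_div_atTop 1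
    have h2 : Tendsto (fun r : ℝ≥0 => 1 / √(r : ℝ)) atTop (𝓝 0) :=
      (Real.tendsto_sqrt_atTop.comp hcoe).const_div_atTop 1
    simpa using ((h1.add (h2.const_mul ((T + 1) / 2))).mul_const (Λ : ℝ)).const_mul 2
  refine tendsto_of_tendsto_of_tendsto_of_le_of_le' tendsto_const_nhds hlim
    (.of_forall fun _ => zero_le) ?_
  filter_upwards [hM, hπ, eventually_gt_atTop 0] with r h1 h2 h3
  exact h2.gap_le h1 h3 G hT c

/-! ### The uniformisations -/

/-- The total rate of a CTMDP, a crude bound on all exit rates. -/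
noncomputable def totalRate (C : CTMDP S A) : ℝ≥0 := ∑ s, ∑ a, C.exit s a

lemma exit_le_totalRate (C : CTMDP S A) (s : S) (a : A) : C.exit s a ≤ C.totalRate :=
  (Finset.single_le_sum (f := C.exit s) (fun _ _ => zero_le) (Finset.mem_univ a)).trans
    (Finset.single_le_sum (f := fun s => ∑ a, C.exit s a) (fun _ _ => zero_le) (Finset.mem_univ s))

lemma hasUniformRate_lateUnif (C : CTMDP S A) {r : ℝ≥0} (hr : C.totalRate ≤ r) :
    (C.lateUnif r).HasUniformRate r := by
  classical
  intro s a _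
  have hle : ∑ s' ∈ Finset.univ.erase s, C.rate s a s' ≤ r :=
    (Finset.sum_le_sum_of_subset (Finset.erase_subset _ _)).trans
      ((C.exit_le_totalRate s a).trans hr)
  rw [exit, ← Finset.add_sum_erase _ _ (Finset.mem_univ s)]
  have h : ∑ s' ∈ Finset.univ.erase s, (C.lateUnif r).rate s a s' =
      ∑ s' ∈ Finset.univ.erase s, C.rate s a s' :=
    Finset.sum_congr rfl fun s' hs' => if_neg (Finset.ne_of_mem_erase hs').symm
  rw [h]
  simp only [lateUnif, if_true]
  convert! tsub_add_cancel_of_le hle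

lemma movesAtRateLE_lateUnif (C : CTMDP S A) (r : ℝ≥0) :
    (C.lateUnif r).MovesAtRateLE id C.totalRate := by
  intro s a
  refine le_trans (Finset.sum_le_sum fun s' _ => ?_) (C.exit_le_totalRate s a)
  by_cases hs : s' = s
  · simp [hs]
  · simp [hs, lateUnif, Ne.symm hs]

lemma exit_earlyUnifUnfrozen (C : CTMDP S A) {r : ℝ≥0} (hr : C.totalRate ≤ r)
    (p : S × Option A) (a : A) : (C.earlyUnifUnfrozen r).exit p a = r := by
  classical
  rw [exit, Fintype.sum_prod_type]
  simp only [Fintype.sum_option, earlyUnifUnfrozen, if_true, reduceCtorEq, if_false,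
    Finset.sum_add_distrib, Option.some.injEq]
  have h : ∑ s', ∑ b, (if b = a ∧ p.1 = s' then r - C.exit p.1 a else 0) = r - C.exit p.1 a := by
    simp [ite_and]
  rw [h]
  exact add_tsub_cancel_of_le ((C.exit_le_totalRate p.1 a).trans hr)

lemma hasUniformRate_earlyUnifUnfrozen (C : CTMDP S A) {r : ℝ≥0} (hr : C.totalRate ≤ r) :
    (C.earlyUnifUnfrozen r).HasUniformRate r :=
  fun p a _ => C.exit_earlyUnifUnfrozen hr p a

lemma movesAtRateLE_earlyUnifUnfrozen (C : CTMDP S A) (r : ℝ≥0) :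
    (C.earlyUnifUnfrozen r).MovesAtRateLE Prod.fst C.totalRate := by
  classical
  intro p a
  refine le_trans ?_ (C.exit_le_totalRate p.1 a)
  rw [Fintype.sum_prod_type]
  refine Finset.sum_le_sum fun s' _ => ?_
  by_cases hs : s' = p.1
  · simp [hs]
  · simp [hs, earlyUnifUnfrozen, Ne.symm hs]

lemma earlyUnif_rate_eq {S A : Type*} [Fintype S] (C : CTMDP S A) (r : ℝ≥0) (p : S × Option A)
    (a : A) :
    (C.earlyUnif r).rate p a = (C.earlyUnifUnfrozen r).rate p a ∨ (C.earlyUnif r).rate p a = 0 := by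
  by_cases h : p.2 = none ∨ p.2 = some a
  · left; ext q; simp [earlyUnif, earlyUnifUnfrozen, h]
  · right; ext q; simp [earlyUnif, h]

lemma hasUniformRate_earlyUnif (C : CTMDP S A) {r : ℝ≥0} (hr : C.totalRate ≤ r) :
    (C.earlyUnif r).HasUniformRate r := by
  rintro p a ⟨q, hq⟩
  rcases C.earlyUnif_rate_eq r p a with h | h
  · rw [exit, h]; exact C.exit_earlyUnifUnfrozen hr p a
  · simp [h] at hq

lemma movesAtRateLE_earlyUnif (C : CTMDP S A) (r : ℝ≥0) :
    (C.earlyUnif r).MovesAtRateLE Prod.fst C.totalRate := by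
  intro p a
  rcases C.earlyUnif_rate_eq r p a with h | h
  · rw [h]; exact C.movesAtRateLE_earlyUnifUnfrozen r p a
  · simp [h]

end CTMDP

theorem mainTheorem2 {S A : Type*} [Fintype S] [Fintype A] (C : CTMDP S A) (G : Set S)
    (T : ℝ) (hT : 0 ≤ T) (c : CTMDP.TAClass) :
    Tendsto (fun r : ℝ≥0 => (C.lateUnif r).gap G T c) atTop (𝓝 0) ∧
    Tendsto (fun r : ℝ≥0 => (C.earlyUnif r).gap {p | p.1 ∈ G} T c) atTop (𝓝 0) ∧
    Tendsto (fun r : ℝ≥0 => (C.earlyUnifUnfrozen r).gap {p | p.1 ∈ G} T c) atTop (𝓝 0) := by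
  have hr : ∀ᶠ r in atTop, C.totalRate ≤ r := eventually_ge_atTop _
  exact ⟨CTMDP.tendsto_gap_zero (hr.mono fun _ h => C.hasUniformRate_lateUnif h)
      (.of_forall C.movesAtRateLE_lateUnif) G hT c,
    CTMDP.tendsto_gap_zero (hr.mono fun _ h => C.hasUniformRate_earlyUnif h)
      (.of_forall C.movesAtRateLE_earlyUnif) G hT c,
    CTMDP.tendsto_gap_zero (hr.mono fun _ h => C.hasUniformRate_earlyUnifUnfrozen h)
      (.of_forall C.movesAtRateLE_earlyUnifUnfrozen) G hT c⟩
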